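/- Let $M$ be a compact smooth manifold of dimension $n\ge 1$ with smooth non-empty boundary $\partial M$, and let $f:M\to[0,1]$ be a Morse function (a smooth function all of whose critical points are nondegenerate) such that $f^{-1}(1)=\partial M$ and $f$ has no local maximum in the interior of $M$. Write $M^a=\{x\in M: f(x)\le a\}$. Let $0\le c<d\le 1$ and $\lambda\in\{0,1,\dots,n-1\}$, and let $p\in f^{-1}(c)$ be a critical point of $f$ of index $\lambda$. Suppose that for some $\varepsilon_1>0$ the set $f^{-1}([c-\varepsilon_1,d])$ contains no critical point of $f$ other than $p$. Then there is $\varepsilon_0>0$ such that for every $\varepsilon\in(0,\varepsilon_0)$ there exists a smooth homotopy $$h:[0,1]\times M^d\to M^d$$ with the following properties: 1. $h(1,\cdot)$ is the identity map of $M^d$; 2. $h(0,M^d)$ is contained in $M^{c-\varepsilon}$ with a $\lambda$-cell attached, that is, $h(0,M^d)\subseteq M^{c-\varepsilon}\cup e$, where $e\subseteq M^d$ is the image of a smooth embedding $\Phi$ of the closed unit ball of $\mathbb R^\lambda$ with $e\cap M^{c-\varepsilon}=\Phi(S^{\lambda-1})$, the image of the unit sphere (for $\lambda=0$, $e$ is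 a point not in $M^{c-\varepsilon}$). -/

import Mathlib

open scoped Manifold ContDiff

noncomputable section

section Morse

variable {E : Type*} [NormedAddCommGroup E] [NormedSpace ℝ E]
  {H : Type*} [TopologicalSpace H] (I : ModelWithCorners ℝ E H)
  {M : Type*} [TopologicalSpace M] [ChartedSpace H M]

/-- `x` is a critical point of `f` if the differential of `f` vanishes at `x`. -/
def IsCriticalPt (f : M → ℝ) (x : M) : Prop :=
  mfderiv I 𝓘(ℝ, ℝ) f x = 0

/-- The Hessian of `f` at `x`, read in the preferred chart at `x`: the bilinear form
`(v, w) ↦ D²(f ∘ φ⁻¹)(φ x) v w`, where `φ = extChartAt I x`. Derivatives are taken within `range I`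
so that the expression makes sense at boundary points as well; at interior points they are the
usual derivatives. It is used at critical points only, where a change of chart merely replaces
it by a congruent form. -/
def chartHessian (f : M → ℝ) (x : M) : LinearMap.BilinForm ℝ E :=
  (fderivWithin ℝ (fderivWithin ℝ (f ∘ (extChartAt I x).symm) (Set.range I)) (Set.range I)
    (extChartAt I x x)).toLinearMap₁₂

/-- A Morse function: a smooth function all of whose critical points are nondegenerate. -/
structure IsMorseFunction (f : M → ℝ) : Prop where
  smooth : ContMDiff I 𝓘(ℝ, ℝ) ∞ f
  nondegenerate : ∀ x, IsCriticalPt I f x → (chartHessian I f x).Nondegenerate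

/-- The index of `f` at a critical point `x`: the maximal dimension of a subspace on which the
Hessian is negative definite. -/
def morseIndex (f : M → ℝ) (x : M) : ℕ :=
  sigNeg (chartHessian I f x).toQuadraticMap

/-- `e` is a `k`-cell attached to `A ⊆ M`, so that `A ∪ e` is `A` with a `k`-cell attached:
`e` is the image of a smooth embedding of the closed unit ball of `ℝᵏ` (a smooth injective
map with injective differential) that meets `A` exactly in the image of the unit sphere. -/
def IsAttachedCell (k : ℕ) (A e : Set M) : Prop :=
  ∃ Φ : EuclideanSpace ℝ (Fin k) → M,
    ContMDiffOn 𝓘(ℝ, EuclideanSpace ℝ (Fin k)) I ∞ Φ (Metric.closedBall 0 1) ∧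
    Set.InjOn Φ (Metric.closedBall 0 1) ∧
    (∀ u ∈ Metric.closedBall (0 : EuclideanSpace ℝ (Fin k)) 1, Function.Injective
      (mfderivWithin 𝓘(ℝ, EuclideanSpace ℝ (Fin k)) I Φ (Metric.closedBall 0 1) u)) ∧
    Φ '' Metric.closedBall 0 1 = e ∧
    e ∩ A = Φ '' Metric.sphere 0 1

end Morse

/-- The closed sublevel set `M^a = {x ∈ M : f x ≤ a}`. -/
def sublevel {M : Type*} (f : M → ℝ) (a : ℝ) : Set M := {x | f x ≤ a}

end

/-!
Away from the critical point `p`, the function can be pushed down locally: at a regular point the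
differential of `f` is negative on some direction pointing into the interior of the model space,
and moving along such a direction in a chart, cut off by a bump function, never leaves the manifold.
At a boundary point this uses that the point is a local maximum, so that no inward direction ascends
and hence some interior one descends. Near `p`, the Morse lemma gives coordinates in which `f` is
`f p - ‖x‖² + ‖y‖²`, and shrinking `y` to `0` collapses a neighbourhood of `p` onto the disk
`y = 0`. By compactness, finitely many such homotopies compose to one which fixes the disk, sends a
neighbourhood of `p` into the union `A` of the disk and the lower sublevel set, and lowers `f` by a
fixed amount on the rest of the slab above that set. Iterating it sends everything into `A`.
-/

noncomputable section

open Set Filter Topology MeasureTheory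

set_option maxSynthPendingDepth 3

section ParametricIntegral

variable {V W : Type*} [NormedAddCommGroup V] [NormedSpace ℝ V] [NormedAddCommGroup W]
  [NormedSpace ℝ W] {G : V × ℝ → W}

theorem hasFDerivAt_intervalIntegral_of_contDiff (hG : ContDiff ℝ 1 G) (a b : ℝ) (x₀ : V) :
    HasFDerivAt (fun x => ∫ t in a..b, G (x, t))
      (∫ t in a..b, (fderiv ℝ G (x₀, t)).comp (ContinuousLinearMap.inl ℝ V ℝ)) x₀ := by
  have hG' : Continuous fun z : V × ℝ => (fderiv ℝ G z).comp (ContinuousLinearMap.inl ℝ V ℝ) :=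
    (hG.continuous_fderiv one_ne_zero).clm_comp continuous_const
  obtain ⟨C, hC⟩ := (isCompact_uIcc (a := a) (b := b)).exists_bound_of_continuousOn
    (hG'.comp (Continuous.prodMk_right x₀)).continuousOn
  have hbound : ∀ᶠ x in 𝓝 x₀, ∀ t ∈ uIcc a b,
      ‖(fderiv ℝ G (x, t)).comp (ContinuousLinearMap.inl ℝ V ℝ)‖ ≤ C + 1 :=
    isCompact_uIcc.eventually_forall_of_forall_eventually fun t ht =>
      (hG'.norm.continuousAt.eventually_lt_const
        ((hC t ht).trans_lt (lt_add_one C))).mono fun _ h => h.le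
  refine intervalIntegral.hasFDerivAt_integral_of_dominated_of_fderiv_le
    (F := fun x t => G (x, t)) (bound := fun _ => C + 1) hbound
    (.of_forall fun x =>
      (hG.continuous.comp (Continuous.prodMk_right x)).aestronglyMeasurable)
    ((hG.continuous.comp (Continuous.prodMk_right x₀)).intervalIntegrable a b)
    (hG'.comp (Continuous.prodMk_right x₀)).aestronglyMeasurable
    (.of_forall fun t ht x hx => hx t (uIoc_subset_uIcc ht)) intervalIntegrable_const
    (.of_forall fun t _ x _ => ?_)
  exact (hG.differentiable one_ne_zero (x, t)).hasFDerivAt.comp x (hasFDerivAt_prodMk_left x t)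

end ParametricIntegral

universe u

theorem contDiff_intervalIntegral {V W : Type u} [NormedAddCommGroup V] [NormedSpace ℝ V]
    [NormedAddCommGroup W] [NormedSpace ℝ W] {G : V × ℝ → W} (hG : ContDiff ℝ ∞ G) (a b : ℝ) :
    ContDiff ℝ ∞ fun x => ∫ t in a..b, G (x, t) := by
  refine contDiff_infty.2 fun n => ?_
  induction n generalizing W with
  | zero =>
    exact contDiff_zero.2 (intervalIntegral.continuous_parametric_intervalIntegral_of_continuous'
      (f := fun x t => G (x, t)) hG.continuous a b)
  | succ n ih =>
    exact contDiff_succ_iff_hasFDerivAt.2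
      ⟨_, ih ((hG.fderiv_right (m := ∞) (by simp)).clm_comp contDiff_const),
        hasFDerivAt_intervalIntegral_of_contDiff (hG.of_le (by simp)) a b⟩

section TaylorTwo

variable {E : Type*} [NormedAddCommGroup E] [NormedSpace ℝ E]

theorem intervalIntegral_apply_apply {S : ℝ → E →L[ℝ] E →L[ℝ] ℝ} (hS : Continuous S)
    (a b : ℝ) (v w : E) : (∫ t in a..b, S t) v w = ∫ t in a..b, S t v w := by
  rw [ContinuousLinearMap.intervalIntegral_apply (hS.intervalIntegrable a b),
    ContinuousLinearMap.intervalIntegral_apply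
      ((hS.clm_apply continuous_const).intervalIntegrable a b)]

/-- The form is twice the integral remainder of Taylor's formula,
`B x = 2 ∫₀¹ (1 - t) D²F (a + t (x - a)) dt`. -/
theorem exists_contDiff_eq_add_apply_sub_sub {F : E → ℝ} (hF : ContDiff ℝ ∞ F) {a : E}
    (ha : fderiv ℝ F a = 0) :
    ∃ B : E → E →L[ℝ] E →L[ℝ] ℝ, ContDiff ℝ ∞ B ∧ B a = fderiv ℝ (fderiv ℝ F) a ∧
      (∀ x v w, B x v w = B x w v) ∧ ∀ x, F x = F a + 1 / 2 * B x (x - a) (x - a) := by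
  set D := fderiv ℝ (fderiv ℝ F)
  have hD : ContDiff ℝ ∞ D :=
    (hF.fderiv_right (m := ∞) (by simp)).fderiv_right (m := ∞) (by simp)
  have hS : ContDiff ℝ ∞ fun z : E × ℝ => (2 * (1 - z.2)) • D (a + z.2 • (z.1 - a)) :=
    (contDiff_const.mul (contDiff_const.sub contDiff_snd)).smul
      (hD.comp (contDiff_const.add (contDiff_snd.smul (contDiff_fst.sub contDiff_const))))
  have hB : ∀ x v w, (∫ t in (0 : ℝ)..1, (2 * (1 - t)) • D (a + t • (x - a))) v w =
      ∫ t in (0 : ℝ)..1, 2 * (1 - t) * D (a + t • (x - a)) v w := fun x =>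
    intervalIntegral_apply_apply (hS.continuous.comp (Continuous.prodMk_right x)) 0 1
  refine ⟨fun x => ∫ t in (0 : ℝ)..1, (2 * (1 - t)) • D (a + t • (x - a)),
    contDiff_intervalIntegral hS 0 1, ?_, fun x v w => ?_, fun x => ?_⟩
  · have hweight : ∫ t in (0 : ℝ)..1, 2 * (1 - t) = 1 := by
      rw [intervalIntegral.integral_const_mul, intervalIntegral.integral_sub (by simp) (by simp)]
      norm_num [integral_id]
    simp only [sub_self, smul_zero, add_zero]
    rw [intervalIntegral.integral_smul_const, hweight, one_smul]
  · have hsymm : ∀ y, D y v w = D y w v := fun y =>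
      hF.contDiffAt.isSymmSndFDerivAt (by
        simp only [minSmoothness_of_isRCLikeNormedField]
        norm_cast) v w
    simp only [hB, hsymm]
  · have htaylor := map_add_eq_sum_add_integral_iteratedFDeriv (n := 1) (f := F) (x := a)
      (y := x - a) fun t _ => hF.contDiffAt.of_le (by norm_cast)
    have hrem : 1 / 2 * ∫ t in (0 : ℝ)..1, 2 * (1 - t) * D (a + t • (x - a)) (x - a) (x - a) =
        ∫ t in (0 : ℝ)..1, (1 - t) * D (a + t • (x - a)) (x - a) (x - a) := by
      rw [← intervalIntegral.integral_const_mul]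
      congr! 2
      ring
    rw [hB, hrem]
    simpa [Finset.sum_range_succ, ha, iteratedFDeriv_two_apply] using htaylor

end TaylorTwo

section InverseFunction

variable {X Y : Type*} [NormedAddCommGroup X] [NormedSpace ℝ X] [CompleteSpace X]
  [NormedAddCommGroup Y] [NormedSpace ℝ Y]

theorem isLocalDiffeomorphAt_of_hasFDerivAt {n : WithTop ℕ∞} (hn : n ≠ 0) {f : X → Y} {s : Set X}
    {a : X} (hs : s ∈ 𝓝 a) (hf : ContDiffOn ℝ n f s) {f' : X ≃L[ℝ] Y}
    (hf' : HasFDerivAt f (f' : X →L[ℝ] Y) a) :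
    IsLocalDiffeomorphAt 𝓘(ℝ, X) 𝓘(ℝ, Y) n f a := by
  have hfa : ContDiffAt ℝ n f a := hf.contDiffAt hs
  have hinv : ∀ᶠ x in 𝓝 a, fderiv ℝ f x ∈ range ((↑) : (X ≃L[ℝ] Y) → X →L[ℝ] Y) :=
    (hfa.continuousAt_fderiv hn).eventually (hf'.fderiv ▸ f'.nhds)
  obtain ⟨u, hu, huo, hau⟩ := mem_nhds_iff.1 (inter_mem hs hinv)
  let P := (hfa.toOpenPartialHomeomorph f hf' hn).restrOpen u huo
  have hP : P.source ⊆ u := inter_subset_right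
  have hat : ∀ x ∈ P.source, ContDiffAt ℝ n f x := fun x hx =>
    hf.contDiffAt (mem_of_superset (huo.mem_nhds (hP hx)) fun y hy => (hu hy).1)
  refine ⟨⟨P.toPartialEquiv, P.open_source, P.open_target,
    contMDiffOn_iff_contDiffOn.2 fun x hx => (hat x hx).contDiffWithinAt,
    contMDiffOn_iff_contDiffOn.2 fun y hy => ?_⟩,
    ⟨hfa.mem_toOpenPartialHomeomorph_source hf' hn, hau⟩, fun x _ => rfl⟩
  have hy' : P.symm y ∈ P.source := P.map_target hy
  obtain ⟨e, he⟩ := (hu (hP hy')).2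
  refine (P.contDiffAt_symm (f₀' := e) hy ?_ (hat _ hy')).contDiffWithinAt
  exact he ▸ ((hat _ hy').differentiableAt hn).hasFDerivAt

end InverseFunction

section SquareRoot

variable {A : Type*} [NormedRing A] [NormedAlgebra ℝ A] [CompleteSpace A]

theorem isLocalDiffeomorphAt_mul_self_one :
    IsLocalDiffeomorphAt 𝓘(ℝ, A) 𝓘(ℝ, A) ∞ (fun x : A => x * x) 1 := by
  refine isLocalDiffeomorphAt_of_hasFDerivAt (by simp) univ_mem (by fun_prop)
    (f' := ContinuousLinearEquiv.smulLeft (Units.mk0 (2 : ℝ) two_ne_zero)) ?_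
  refine ((hasFDerivAt_id (1 : A)).mul' (hasFDerivAt_id (1 : A))).congr_fderiv ?_
  ext x
  simp [Units.smul_def, two_smul]

/-- The root commutes with `σ` because it is the only one near `1`. -/
theorem exists_contDiffOn_mul_self_eq {σ : A → A} (hσ : ContinuousAt σ 1) (hσ1 : σ 1 = 1)
    (hσmul : ∀ x, σ (x * x) = σ x * σ x) :
    ∃ u ∈ 𝓝 (1 : A), ∃ R : A → A, ContDiffOn ℝ ∞ R u ∧ R 1 = 1 ∧
      ∀ x ∈ u, R x * R x = x ∧ (σ x = x → σ (R x) = R x) := by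
  obtain ⟨P, hP1, hP⟩ := isLocalDiffeomorphAt_mul_self_one (A := A)
  have hsq : ∀ y ∈ P.source, P y = y * y := fun y hy => (hP hy).symm
  have hP1' : P 1 = 1 := (hsq 1 hP1).trans (one_mul 1)
  set R := P.toPartialEquiv.symm
  have hR1 : R 1 = 1 := by conv_lhs => rw [← hP1', P.left_inv hP1]
  have h1 : P.target ∈ 𝓝 (1 : A) := P.open_target.mem_nhds (hP1' ▸ P.map_source hP1)
  have hR : ContDiffOn ℝ ∞ R P.target := contMDiffOn_iff_contDiffOn.1 P.contMDiffOn_invFun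
  have hσR : ∀ᶠ x in 𝓝 1, σ (R x) ∈ P.source := by
    refine (ContinuousAt.comp (f := R) (by rwa [hR1])
      (hR.continuousOn.continuousAt h1)).preimage_mem_nhds (P.open_source.mem_nhds ?_)
    rwa [Function.comp_apply, hR1, hσ1]
  refine ⟨_, inter_mem h1 hσR, R, hR.mono inter_subset_left, hR1, ?_⟩
  rintro x ⟨hx, hσx⟩
  have hRx : R x ∈ P.source := P.map_target hx
  have hroot : R x * R x = x := by rw [← hsq _ hRx, P.right_inv hx]
  refine ⟨hroot, fun hfix => P.injOn hσx hRx ?_⟩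
  rw [hsq _ hσx, hsq _ hRx, ← hσmul, hroot, hfix]

end SquareRoot

section MorseLemma

variable {E : Type*} [NormedAddCommGroup E] [NormedSpace ℝ E]

theorem exists_contDiff_eventuallyEq [HasContDiffBump E] {W : Type*} [NormedAddCommGroup W]
    [NormedSpace ℝ W] {F : E → W} {n : ℕ∞} {s : Set E} {a : E} (hs : s ∈ 𝓝 a)
    (hF : ContDiffOn ℝ n F s) : ∃ G : E → W, ContDiff ℝ n G ∧ G =ᶠ[𝓝 a] F := by
  obtain ⟨r, hr, hrs⟩ := Metric.mem_nhds_iff.1 hs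
  let b : ContDiffBump a := ⟨r / 3, r / 2, by positivity, by linarith⟩
  have htsupport : tsupport b ⊆ Metric.ball a r := by
    rw [b.tsupport_eq]
    exact Metric.closedBall_subset_ball (half_lt_self hr)
  refine ⟨fun x => b x • F x, contMDiff_iff_contDiff.1 (contMDiff_of_tsupport fun x hx => ?_), ?_⟩
  · have hxs : s ∈ 𝓝 x := mem_of_superset
      (Metric.isOpen_ball.mem_nhds (htsupport (tsupport_smul_subset_left _ _ hx))) hrs
    exact (b.contDiffAt.smul (hF.contDiffAt hxs)).contMDiffAt
  · filter_upwards [b.eventuallyEq_one] with x hx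
    rw [hx, Pi.one_apply, one_smul]

/-- The adjoint of an endomorphism with respect to a nondegenerate bilinear form `J`. -/
def formAdjoint (J : E ≃L[ℝ] E →L[ℝ] ℝ) (C : E →L[ℝ] E) : E →L[ℝ] E :=
  (J.symm : (E →L[ℝ] ℝ) →L[ℝ] E) ∘L (ContinuousLinearMap.compL ℝ E E ℝ).flip C ∘L
    (J : E →L[ℝ] E →L[ℝ] ℝ)

theorem apply_formAdjoint (J : E ≃L[ℝ] E →L[ℝ] ℝ) (C : E →L[ℝ] E) (v w : E) :
    J (formAdjoint J C v) w = J v (C w) := by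
  simp [formAdjoint]

theorem eq_formAdjoint_iff {J : E ≃L[ℝ] E →L[ℝ] ℝ} {C D : E →L[ℝ] E} :
    D = formAdjoint J C ↔ ∀ v w, J (D v) w = J v (C w) := by
  refine ⟨fun h v w => h ▸ apply_formAdjoint J C v w, fun h => ?_⟩
  ext v
  refine J.injective (ContinuousLinearMap.ext fun w => ?_)
  rw [h, apply_formAdjoint]

theorem continuous_formAdjoint (J : E ≃L[ℝ] E →L[ℝ] ℝ) : Continuous (formAdjoint J) :=
  continuous_const.clm_comp
    (((ContinuousLinearMap.compL ℝ E E ℝ).flip.continuous).clm_comp continuous_const)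

theorem exists_contDiffOn_apply_apply_eq [CompleteSpace E] (J : E ≃L[ℝ] E →L[ℝ] ℝ)
    (hJ : ∀ v w, J v w = J w v) :
    ∃ u ∈ 𝓝 (J : E →L[ℝ] E →L[ℝ] ℝ), ∃ C : (E →L[ℝ] E →L[ℝ] ℝ) → E →L[ℝ] E,
      ContDiffOn ℝ ∞ C u ∧ C J = .id ℝ E ∧
      ∀ B ∈ u, (∀ v w, B v w = B w v) → ∀ v, J (C B v) (C B v) = B v v := by
  let S : (E →L[ℝ] E →L[ℝ] ℝ) → E →L[ℝ] E := fun B => (J.symm : (E →L[ℝ] ℝ) →L[ℝ] E) ∘L B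
  have hS : ContDiff ℝ ∞ S := contDiff_const.clm_comp contDiff_id
  have hJS : ∀ B v w, J (S B v) w = B v w := fun B v w => by simp [S]
  have hSJ : S J = 1 := by ext; simp [S]
  obtain ⟨u, hu, R, hR, hR1, hRu⟩ := exists_contDiffOn_mul_self_eq (σ := formAdjoint J)
    (continuous_formAdjoint J).continuousAt
    (eq_formAdjoint_iff.2 fun v w => rfl).symm
    fun C => (eq_formAdjoint_iff.2 fun v w => by
      simp only [mul_apply_eq_comp, apply_formAdjoint]).symm
  refine ⟨S ⁻¹' u, hS.continuous.continuousAt.preimage_mem_nhds (by rwa [hSJ]), fun B => R (S B),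
    hR.comp hS.contDiffOn fun B hB => hB, (congrArg R hSJ).trans hR1, fun B hB hBsymm v => ?_⟩
  obtain ⟨hsq, hadj⟩ := hRu (S B) hB
  have hSB : formAdjoint J (S B) = S B := (eq_formAdjoint_iff.2 fun v w => by
    rw [hJ v, hJS, hJS, hBsymm]).symm
  calc J (R (S B) v) (R (S B) v)
      = J (formAdjoint J (R (S B)) v) (R (S B) v) := by rw [hadj hSB]
    _ = J v ((R (S B) * R (S B)) v) := apply_formAdjoint J _ _ _
    _ = B v v := by rw [hsq, hJ, hJS]

/-- The new coordinates are `T x = C x (x - a)`, where `F x = F a + 1 / 2 * B x (x - a) (x - a)` and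
`C x`, with `C a = 1`, is the square root of `J⁻¹ ∘ B x`; since `C x` is self-adjoint for `J`, it
pulls `J` back to `B x`. -/
theorem exists_isLocalDiffeomorphAt_eq_add_apply_apply [CompleteSpace E] [HasContDiffBump E]
    {F : E → ℝ} {s : Set E} {a : E} (hs : s ∈ 𝓝 a) (hF : ContDiffOn ℝ ∞ F s)
    (ha : fderiv ℝ F a = 0) (J : E ≃L[ℝ] E →L[ℝ] ℝ) (hJ : fderiv ℝ (fderiv ℝ F) a = J) :
    ∃ T : E → E, IsLocalDiffeomorphAt 𝓘(ℝ, E) 𝓘(ℝ, E) ∞ T a ∧ T a = 0 ∧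
      ∀ᶠ x in 𝓝 a, F x = F a + 1 / 2 * J (T x) (T x) := by
  obtain ⟨G, hG, hGF⟩ := exists_contDiff_eventuallyEq hs hF
  obtain ⟨B, hB, hBa, hBsymm, hGB⟩ :=
    exists_contDiff_eq_add_apply_sub_sub hG (hGF.fderiv_eq.trans ha)
  rw [hGF.fderiv.fderiv_eq, hJ] at hBa
  obtain ⟨u, hu, C, hC, hCJ, hCB⟩ := exists_contDiffOn_apply_apply_eq J
    fun v w => by simpa [hBa] using hBsymm a v w
  have hBu : B ⁻¹' u ∈ 𝓝 a := hB.continuous.continuousAt.preimage_mem_nhds (hBa ▸ hu)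
  have hCB' : ContDiffOn ℝ ∞ (fun x => C (B x)) (B ⁻¹' u) := hC.comp hB.contDiffOn fun x hx => hx
  have hT : ContDiffOn ℝ ∞ (fun x => C (B x) (x - a)) (B ⁻¹' u) :=
    hCB'.clm_apply (contDiff_id.sub contDiff_const).contDiffOn
  have hT' : HasFDerivAt (fun x => C (B x) (x - a))
      (ContinuousLinearEquiv.refl ℝ E : E →L[ℝ] E) a := by
    refine (((hCB'.contDiffAt hBu).differentiableAt (by simp)).hasFDerivAt.clm_apply
      ((hasFDerivAt_id a).sub_const a)).congr_fderiv ?_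
    ext v
    simp [hBa, hCJ]
  refine ⟨_, isLocalDiffeomorphAt_of_hasFDerivAt (by simp) hBu hT hT', by simp, ?_⟩
  filter_upwards [hBu, hGF] with x hx hGx
  rw [hCB (B x) hx (hBsymm x), ← hGx, ← hGF.eq_of_nhds, ← hGB]

end MorseLemma

/-- The product `ℝᵏ × ℝᵐ` on which the Morse lemma puts a function of index `k` in the form
`-‖x‖² + ‖y‖²`. -/
abbrev MorseModel (k m : ℕ) : Type := EuclideanSpace ℝ (Fin k) × EuclideanSpace ℝ (Fin m)

section Sylvester

theorem exists_linearEquiv_weightedSumSquares_eq {ι : Type*} [Fintype ι] {w : ι → ℝ}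
    (hw : ∀ i, w i = -1 ∨ w i = 1) :
    ∃ L : MorseModel (Nat.card {i // w i < 0}) (Nat.card {i // ¬ w i < 0}) ≃ₗ[ℝ] (ι → ℝ),
      ∀ z, QuadraticMap.weightedSumSquares ℝ w (L z) = -‖z.1‖ ^ 2 + ‖z.2‖ ^ 2 := by
  let σ : Fin (Nat.card {i // w i < 0}) ⊕ Fin (Nat.card {i // ¬ w i < 0}) ≃ ι :=
    ((Finite.equivFin _).symm.sumCongr (Finite.equivFin _).symm).trans (Equiv.sumCompl _)
  have hneg : ∀ i, w (σ (.inl i)) = -1 := fun i =>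
    (hw _).resolve_right fun h => by
      have : w (σ (.inl i)) < 0 := ((Finite.equivFin {i // w i < 0}).symm i).2
      linarith
  have hpos : ∀ i, w (σ (.inr i)) = 1 := fun i =>
    (hw _).resolve_left fun h => by
      have : ¬ w (σ (.inr i)) < 0 := ((Finite.equivFin {i // ¬ w i < 0}).symm i).2
      linarith
  let L := (((WithLp.linearEquiv 2 ℝ _).prodCongr (WithLp.linearEquiv 2 ℝ _)).trans
    (LinearEquiv.sumArrowLequivProdArrow _ _ ℝ ℝ).symm).trans (LinearEquiv.funCongrLeft ℝ ℝ σ).symm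
  have hL : ∀ z j, L z (σ j) = Sum.elim z.1 z.2 j := fun z j =>
    congrArg (Sum.elim z.1 z.2) (σ.symm_apply_apply j)
  refine ⟨L, fun z => ?_⟩
  rw [QuadraticMap.weightedSumSquares_apply, ← σ.sum_comp, Fintype.sum_sum_type,
    EuclideanSpace.real_norm_sq_eq, EuclideanSpace.real_norm_sq_eq]
  simp [hL, hneg, hpos, sq]

theorem exists_linearEquiv_eq_neg_sq_add_sq {E : Type*} [AddCommGroup E] [Module ℝ E]
    [FiniteDimensional ℝ E] (Q : QuadraticForm ℝ E)
    (hQ : (QuadraticMap.associated (R := ℝ) Q).SeparatingLeft) :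
    ∃ m : ℕ, ∃ L : MorseModel (sigNeg Q) m ≃ₗ[ℝ] E,
      ∀ z, Q (L z) = -‖z.1‖ ^ 2 + ‖z.2‖ ^ 2 := by
  obtain ⟨w, hw, hQw⟩ := QuadraticForm.equivalent_one_neg_one_weighted_sum_squared Q hQ
  have hsig : sigNeg Q = Nat.card {i // w i < 0} :=
    QuadraticForm.sigNeg_of_equiv_weightedSumSquares hQw
  obtain ⟨e⟩ := hQw
  obtain ⟨L, hL⟩ := exists_linearEquiv_weightedSumSquares_eq hw
  rw [hsig]
  exact ⟨_, L.trans e.symm.toLinearEquiv, fun z => (e.symm.map_app _).trans (hL z)⟩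

end Sylvester

section MorseCoordinates

variable {E : Type*} [NormedAddCommGroup E] [NormedSpace ℝ E] [FiniteDimensional ℝ E]

theorem exists_isLocalDiffeomorphAt_eq_sub_sq_add_sq {F : E → ℝ} {s : Set E} {a : E}
    (hs : s ∈ 𝓝 a) (hF : ContDiffOn ℝ ∞ F s) (ha : fderiv ℝ F a = 0) {Q : LinearMap.BilinForm ℝ E}
    (hQ : (fderiv ℝ (fderiv ℝ F) a).toLinearMap₁₂ = Q) (hnd : Q.Nondegenerate) :
    ∃ (m : ℕ) (T : E → MorseModel (sigNeg Q.toQuadraticMap) m),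
      IsLocalDiffeomorphAt 𝓘(ℝ, E) 𝓘(ℝ, MorseModel (sigNeg Q.toQuadraticMap) m) ∞ T a ∧ T a = 0 ∧
      ∀ᶠ x in 𝓝 a, F x = F a - ‖(T x).1‖ ^ 2 + ‖(T x).2‖ ^ 2 := by
  have hQsymm : ∀ v w, Q v w = Q w v := fun v w => hQ ▸
    (hF.contDiffAt hs).isSymmSndFDerivAt (by
      simp only [minSmoothness_of_isRCLikeNormedField]
      norm_cast) v w
  obtain ⟨m, L, hL⟩ := exists_linearEquiv_eq_neg_sq_add_sq Q.toQuadraticMap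
    (by rw [QuadraticMap.associated_left_inverse ℝ hQsymm]; exact hnd.1)
  let J : E ≃L[ℝ] E →L[ℝ] ℝ :=
    ((Q.toDual hnd).trans LinearMap.toContinuousLinearMap).toContinuousLinearEquiv
  have hJ : ∀ v w, J v w = Q v w := fun v w => rfl
  obtain ⟨T, hT, hTa, hFT⟩ := exists_isLocalDiffeomorphAt_eq_add_apply_apply hs hF ha J
    (by ext v w; rw [← hQ] at hJ; exact (hJ v w).symm)
  let K := (L.trans (LinearEquiv.smulOfNeZero ℝ E (√2) (by positivity))).toContinuousLinearEquiv
  have hK : ∀ z, 1 / 2 * Q (K z) (K z) = -‖z.1‖ ^ 2 + ‖z.2‖ ^ 2 := fun z => by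
    have hQK : Q (K z) (K z) = √2 * (√2 * Q (L z) (L z)) := by
      simp [K]
    rw [hQK, ← mul_assoc √2, Real.mul_self_sqrt zero_le_two, ← hL z]
    simp
  refine ⟨m, K.symm ∘ T, hT.comp _ _ (K.symm.toDiffeomorph.isLocalDiffeomorph _), by simp [hTa], ?_⟩
  filter_upwards [hFT] with x hx
  have := hK (K.symm (T x))
  rw [K.apply_symm_apply] at this
  rw [hx, hJ, this, Function.comp_apply]
  ring

end MorseCoordinates

section MorseCoordinatesOnManifold

variable {E : Type*} [NormedAddCommGroup E] [NormedSpace ℝ E]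
  {H : Type*} [TopologicalSpace H] {I : ModelWithCorners ℝ E H}
  {M : Type*} [TopologicalSpace M] [ChartedSpace H M]

theorem isLocalDiffeomorphAt_extChartAt {n : WithTop ℕ∞} [IsManifold I n M] {p : M}
    (hp : I.IsInteriorPoint p) : IsLocalDiffeomorphAt I 𝓘(ℝ, E) n (extChartAt I p) p := by
  set φ := extChartAt I p
  let e := (φ.symm.restr (interior φ.target)).symm
  have hsource : e.source ⊆ φ.source := inter_subset_left
  have htarget : e.target ⊆ φ.target := inter_subset_left
  refine ⟨⟨e, isOpen_extChartAt_preimage' p isOpen_interior, ?_,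
    contMDiffOn_extChartAt.mono (hsource.trans (extChartAt_source I p).subset),
    (contMDiffOn_extChartAt_symm p).mono htarget⟩,
    ⟨mem_extChartAt_source p, ModelWithCorners.isInteriorPoint_iff.1 hp⟩, fun x _ => rfl⟩
  have : e.target = interior φ.target := inter_eq_right.2 interior_subset
  exact this ▸ isOpen_interior

theorem fderiv_comp_extChartAt_symm_eq_zero {f : M → ℝ} {p : M}
    (hf : MDifferentiableAt I 𝓘(ℝ, ℝ) f p) (hpi : I.IsInteriorPoint p) (hp : IsCriticalPt I f p) :
    fderiv ℝ (f ∘ (extChartAt I p).symm) (extChartAt I p p) = 0 := by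
  have h : mfderiv I 𝓘(ℝ, ℝ) f p = 0 := hp
  rwa [hf.mfderiv, fderivWithin_of_mem_nhds (mem_interior_iff_mem_nhds.1 hpi)] at h

theorem toLinearMap₁₂_fderiv_fderiv_eq_chartHessian {f : M → ℝ} {p : M}
    (hpi : I.IsInteriorPoint p) :
    (fderiv ℝ (fderiv ℝ (f ∘ (extChartAt I p).symm)) (extChartAt I p p)).toLinearMap₁₂ =
      chartHessian I f p := by
  have hR : range I ∈ 𝓝 (extChartAt I p p) := mem_interior_iff_mem_nhds.1 hpi
  have hD : fderivWithin ℝ (f ∘ (extChartAt I p).symm) (range I) =ᶠ[𝓝 (extChartAt I p p)]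
      fderiv ℝ (f ∘ (extChartAt I p).symm) :=
    (eventually_mem_nhds_iff.2 hR).mono fun x hx => fderivWithin_of_mem_nhds hx
  rw [chartHessian, fderivWithin_of_mem_nhds hR, hD.fderiv_eq]

theorem exists_isLocalDiffeomorphAt_morseModel [FiniteDimensional ℝ E] [IsManifold I ∞ M]
    {f : M → ℝ} (hf : ContMDiff I 𝓘(ℝ, ℝ) ∞ f) {p : M} (hpi : I.IsInteriorPoint p)
    (hp : IsCriticalPt I f p) (hnd : (chartHessian I f p).Nondegenerate) :
    ∃ (m : ℕ) (θ : M → MorseModel (morseIndex I f p) m),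
      IsLocalDiffeomorphAt I 𝓘(ℝ, MorseModel (morseIndex I f p) m) ∞ θ p ∧ θ p = 0 ∧
      ∀ᶠ x in 𝓝 p, f x = f p - ‖(θ x).1‖ ^ 2 + ‖(θ x).2‖ ^ 2 := by
  have hF : ContDiffOn ℝ ∞ (f ∘ (extChartAt I p).symm) (extChartAt I p).target :=
    contMDiffOn_iff_contDiffOn.1 (hf.comp_contMDiffOn (contMDiffOn_extChartAt_symm p))
  obtain ⟨m, T, hT, hT0, hFT⟩ := exists_isLocalDiffeomorphAt_eq_sub_sq_add_sq
    (mem_interior_iff_mem_nhds.1 (ModelWithCorners.isInteriorPoint_iff.1 hpi)) hF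
    (fderiv_comp_extChartAt_symm_eq_zero (hf.mdifferentiable (by simp) p) hpi hp)
    (toLinearMap₁₂_fderiv_fderiv_eq_chartHessian hpi) hnd
  refine ⟨m, T ∘ extChartAt I p, (isLocalDiffeomorphAt_extChartAt hpi).comp _ _ hT, hT0, ?_⟩
  filter_upwards [(continuousAt_extChartAt p).eventually hFT, extChartAt_source_mem_nhds (I := I) p]
    with x hFx hx
  simp only [Function.comp_apply, (extChartAt I p).left_inv hx, extChartAt_to_inv] at hFx
  exact hFx

end MorseCoordinatesOnManifold

section DescendingHomotopy

variable {E : Type*} [NormedAddCommGroup E] [NormedSpace ℝ E]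
  {H : Type*} [TopologicalSpace H] (I : ModelWithCorners ℝ E H)
  {M : Type*} [TopologicalSpace M] [ChartedSpace H M]

/-- A smooth homotopy from a map `h (0, ·)` to the identity `h (1, ·)` along which `f` does not
increase, and such that `h (0, ·)` fixes the points of `e` and strictly decreases `f` at every
point that it moves. Time is allowed to range over all of `ℝ`, which spares a boundary. -/
structure IsDescendingHomotopy (f : M → ℝ) (e : Set M) (h : ℝ × M → M) : Prop where
  contMDiff : ContMDiff (𝓘(ℝ, ℝ).prod I) I ∞ h
  apply_one : ∀ x, h (1, x) = x
  le : ∀ t x, f (h (t, x)) ≤ f x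
  apply_zero_of_mem : ∀ x ∈ e, h (0, x) = x
  eq_or_lt : ∀ x, h (0, x) = x ∨ f (h (0, x)) < f x

variable {I} {f : M → ℝ} {e : Set M} {h h₁ h₂ : ℝ × M → M}

theorem isDescendingHomotopy_snd : IsDescendingHomotopy I f e Prod.snd :=
  ⟨contMDiff_snd, fun _ => rfl, fun _ _ => le_rfl, fun _ _ => rfl, fun _ => Or.inl rfl⟩

namespace IsDescendingHomotopy

theorem mono {e' : Set M} (he : e' ⊆ e) (hh : IsDescendingHomotopy I f e h) :
    IsDescendingHomotopy I f e' h :=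
  { hh with apply_zero_of_mem := fun x hx => hh.apply_zero_of_mem x (he hx) }

theorem comp (hh₁ : IsDescendingHomotopy I f e h₁) (hh₂ : IsDescendingHomotopy I f e h₂) :
    IsDescendingHomotopy I f e fun z => h₁ (z.1, h₂ z) where
  contMDiff := hh₁.contMDiff.comp (contMDiff_fst.prodMk hh₂.contMDiff)
  apply_one x := by rw [hh₂.apply_one, hh₁.apply_one]
  le t x := (hh₁.le t _).trans (hh₂.le t x)
  apply_zero_of_mem x hx := by rw [hh₂.apply_zero_of_mem x hx, hh₁.apply_zero_of_mem x hx]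
  eq_or_lt x := by
    rcases hh₂.eq_or_lt x with hx | hx
    · rw [hx]
      exact hh₁.eq_or_lt x
    · exact Or.inr ((hh₁.le 0 _).trans_lt hx)

theorem comp_lt (hh₁ : IsDescendingHomotopy I f e h₁) (hh₂ : IsDescendingHomotopy I f e h₂)
    {x : M} (hx : f (h₁ (0, x)) < f x ∨ f (h₂ (0, x)) < f x) : f (h₁ (0, h₂ (0, x))) < f x := by
  rcases hh₂.eq_or_lt x with h2 | h2
  · rw [h2] at hx ⊢
    exact hx.resolve_right (lt_irrefl _)
  · exact (hh₁.le 0 _).trans_lt h2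

theorem mapsTo_sublevel_union (hh : IsDescendingHomotopy I f e h) (a : ℝ) :
    MapsTo (fun x => h (0, x)) (sublevel f a ∪ e) (sublevel f a ∪ e) := by
  rintro x (hx | hx)
  · exact Or.inl ((hh.le 0 x).trans hx)
  · exact Or.inr (mem_of_eq_of_mem (hh.apply_zero_of_mem x hx) hx)

theorem exists_le_sub_of_isCompact (hh : IsDescendingHomotopy I f e h) (hf : Continuous f)
    {K : Set M} (hK : IsCompact K) (hlt : ∀ x ∈ K, f (h (0, x)) < f x) :
    ∃ δ > 0, ∀ x ∈ K, f (h (0, x)) ≤ f x - δ := by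
  have hcont : Continuous fun x => f x - f (h (0, x)) :=
    hf.sub (hf.comp (hh.contMDiff.continuous.comp (by fun_prop)))
  obtain ⟨δ, hδ, hle⟩ :=
    hK.exists_forall_le' hcont.continuousOn fun x hx => sub_pos.2 (hlt x hx)
  exact ⟨δ, hδ, fun x hx => le_sub_comm.1 (hle x hx)⟩

theorem exists_mem_or_le_sub_nsmul (hh : IsDescendingHomotopy I f e h) {A : Set M} {d δ : ℝ}
    (hA : MapsTo (fun x => h (0, x)) A A)
    (hdrop : ∀ x ∈ sublevel f d, h (0, x) ∈ A ∨ f (h (0, x)) ≤ f x - δ) (N : ℕ) :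
    ∃ g, IsDescendingHomotopy I f e g ∧
      ∀ x ∈ sublevel f d, g (0, x) ∈ A ∨ f (g (0, x)) ≤ d - N • δ := by
  induction N with
  | zero =>
    exact ⟨_, isDescendingHomotopy_snd, fun x hx => Or.inr (by simpa only [zero_nsmul, sub_zero])⟩
  | succ N ih =>
    obtain ⟨g, hg, hgA⟩ := ih
    refine ⟨_, hh.comp hg, fun x hx => ?_⟩
    rcases hgA x hx with hmem | hle
    · exact Or.inl (hA hmem)
    · refine (hdrop _ ((hg.le 0 x).trans hx)).imp_right fun hstep => ?_
      rw [succ_nsmul]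
      linarith

theorem exists_mapsTo (hh : IsDescendingHomotopy I f e h) (hf : Continuous f) {A C : Set M}
    {a d : ℝ} (hK : IsCompact (f ⁻¹' Icc a d)) (hC : IsOpen C) (haA : sublevel f a ⊆ A)
    (hA : MapsTo (fun x => h (0, x)) A A) (hCA : MapsTo (fun x => h (0, x)) C A)
    (hlt : ∀ x ∈ f ⁻¹' Icc a d \ C, f (h (0, x)) < f x) :
    ∃ g, IsDescendingHomotopy I f e g ∧ MapsTo (fun x => g (0, x)) (sublevel f d) A := by
  obtain ⟨δ, hδ, hle⟩ := hh.exists_le_sub_of_isCompact hf (hK.diff hC) hlt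
  have hdrop : ∀ x ∈ sublevel f d, h (0, x) ∈ A ∨ f (h (0, x)) ≤ f x - δ := fun x hx => by
    by_cases hxC : x ∈ C
    · exact Or.inl (hCA hxC)
    by_cases hxa : f x ≤ a
    · exact Or.inl (hA (haA hxa))
    · exact Or.inr (hle x ⟨⟨(not_le.1 hxa).le, hx⟩, hxC⟩)
  obtain ⟨N, hN⟩ := Archimedean.arch (d - a) hδ
  obtain ⟨g, hg, hgA⟩ := hh.exists_mem_or_le_sub_nsmul hA hdrop N
  exact ⟨g, hg, fun x hx => (hgA x hx).elim id fun h => haA (h.trans (by linarith))⟩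

end IsDescendingHomotopy

theorem exists_isDescendingHomotopy_lt_of_isCompact {K : Set M} (hK : IsCompact K)
    (hloc : ∀ x ∈ K, ∃ h, IsDescendingHomotopy I f e h ∧ ∀ᶠ y in 𝓝 x, f (h (0, y)) < f y) :
    ∃ h, IsDescendingHomotopy I f e h ∧ ∀ x ∈ K, f (h (0, x)) < f x := by
  refine hK.induction_on (p := fun S => ∃ h, IsDescendingHomotopy I f e h ∧
    ∀ x ∈ S, f (h (0, x)) < f x) ⟨_, isDescendingHomotopy_snd, fun _ => False.elim⟩ ?_ ?_ ?_
  · rintro s t hst ⟨h, hh, hlt⟩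
    exact ⟨h, hh, fun x hx => hlt x (hst hx)⟩
  · rintro s t ⟨h₁, hh₁, hlt₁⟩ ⟨h₂, hh₂, hlt₂⟩
    exact ⟨_, hh₁.comp hh₂, fun x hx => hh₁.comp_lt hh₂ (hx.imp (hlt₁ x) (hlt₂ x))⟩
  · intro x hx
    obtain ⟨h, hh, hlt⟩ := hloc x hx
    exact ⟨_, mem_nhdsWithin_of_mem_nhds hlt, h, hh, fun _ => id⟩

end DescendingHomotopy

section Displacement

variable {M X : Type*} [NormedAddCommGroup X] [NormedSpace ℝ X] [HasContDiffBump X]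

open Classical in
/-- The homotopy which, in the coordinates `φ`, moves `z` to `z + w z` as time runs from `1` to `0`.
The bump function `b` cuts it off so that it extends by the identity outside of the chart. -/
def displacement (φ : PartialEquiv M X) {a : X} (b : ContDiffBump a) (w : X → X) (z : ℝ × M) : M :=
  if z.2 ∈ φ.source then
    φ.symm (φ z.2 + (Real.smoothTransition (1 - z.1) * b (φ z.2)) • w (φ z.2))
  else z.2

variable {φ : PartialEquiv M X} {a : X} {b : ContDiffBump a} {w : X → X}

theorem smoothTransition_mul_contDiffBump_mem_Icc (b : ContDiffBump a) (t : ℝ) (z : X) :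
    Real.smoothTransition t * b z ∈ Icc (0 : ℝ) 1 :=
  ⟨mul_nonneg (Real.smoothTransition.nonneg _) b.nonneg,
    mul_le_one₀ (Real.smoothTransition.le_one _) b.nonneg b.le_one⟩

theorem displacement_of_smul_eq_zero {t : ℝ} {x : M}
    (hx : x ∈ φ.source → (Real.smoothTransition (1 - t) * b (φ x)) • w (φ x) = 0) :
    displacement φ b w (t, x) = x := by
  by_cases hxs : x ∈ φ.source
  · rw [displacement, if_pos hxs, hx hxs, add_zero, φ.left_inv hxs]
  · exact if_neg hxs

theorem smul_eq_zero_of_notMem_ball {z : X} (hz : z ∉ Metric.ball a b.rOut) (s : ℝ) (v : X) :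
    (s * b z) • v = 0 := by
  rw [b.zero_of_le_dist (not_lt.1 hz), mul_zero, zero_smul]

theorem displacement_zero {x : M} (hx : x ∈ φ.source) (hxb : φ x ∈ Metric.closedBall a b.rIn) :
    displacement φ b w (0, x) = φ.symm (φ x + w (φ x)) := by
  rw [displacement, if_pos hx, b.one_of_mem_closedBall hxb, sub_zero, Real.smoothTransition.one,
    one_mul, one_smul]

variable {E : Type*} [NormedAddCommGroup E] [NormedSpace ℝ E]
  {H : Type*} [TopologicalSpace H] {I : ModelWithCorners ℝ E H}
  [TopologicalSpace M] [T2Space M] [ChartedSpace H M]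

theorem contMDiff_displacement (hs : IsOpen φ.source)
    (hφ : ContMDiffOn I 𝓘(ℝ, X) ∞ φ φ.source) (hφs : ContMDiffOn 𝓘(ℝ, X) I ∞ φ.symm φ.target)
    (hK : IsCompact (φ.target ∩ Metric.closedBall a b.rOut)) (hw : ContDiff ℝ ∞ w)
    (hwt : ∀ z ∈ φ.target ∩ Metric.ball a b.rOut, ∀ s ∈ Icc (0 : ℝ) 1, z + s • w z ∈ φ.target) :
    ContMDiff (𝓘(ℝ, ℝ).prod I) I ∞ (displacement φ b w) := by
  have hKc : IsClosed (φ.symm '' (φ.target ∩ Metric.closedBall a b.rOut)) :=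
    (hK.image_of_continuousOn (hφs.continuousOn.mono inter_subset_left)).isClosed
  rintro ⟨t, x⟩
  by_cases hx : x ∈ φ.source
  · let G : ℝ × X → X := fun z => z.2 + (Real.smoothTransition (1 - z.1) * b z.2) • w z.2
    have hG : ContDiff ℝ ∞ G := contDiff_snd.add (((Real.smoothTransition.contDiff.comp
      (contDiff_const.sub contDiff_fst)).mul (b.contDiff.comp contDiff_snd)).smul
      (hw.comp contDiff_snd))
    have hGt : ∀ z : ℝ × M, z.2 ∈ φ.source → G (z.1, φ z.2) ∈ φ.target := fun z hz => by
      by_cases hzb : φ z.2 ∈ Metric.ball a b.rOut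
      · exact hwt _ ⟨φ.map_source hz, hzb⟩ _ (smoothTransition_mul_contDiffBump_mem_Icc b _ _)
      · simpa only [G, smul_eq_zero_of_notMem_ball hzb, add_zero] using φ.map_source hz
    have hφ' : ContMDiffOn (𝓘(ℝ, ℝ).prod I) 𝓘(ℝ, ℝ × X) ∞ (fun z : ℝ × M => (z.1, φ z.2))
        (univ ×ˢ φ.source) :=
      contMDiffOn_fst.prodMk_space (hφ.comp contMDiffOn_snd fun _ hz => hz.2)
    refine ((hφs.comp (hG.contMDiff.comp_contMDiffOn hφ') fun z hz => hGt z hz.2).congr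
      fun z hz => if_pos hz.2).contMDiffAt ((isOpen_univ.prod hs).mem_nhds ⟨mem_univ _, hx⟩)
  · have hxK : x ∉ φ.symm '' (φ.target ∩ Metric.closedBall a b.rOut) := by
      rintro ⟨z, hz, rfl⟩
      exact hx (φ.map_target hz.1)
    refine contMDiffAt_snd.congr_of_eventuallyEq ?_
    filter_upwards [continuousAt_snd.eventually (hKc.isOpen_compl.mem_nhds hxK)] with z hz
    refine displacement_of_smul_eq_zero fun hzs =>
      smul_eq_zero_of_notMem_ball (fun hzb => hz ?_) _ _
    exact ⟨φ z.2, ⟨φ.map_source hzs, Metric.ball_subset_closedBall hzb⟩, φ.left_inv hzs⟩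

theorem isDescendingHomotopy_displacement (hs : IsOpen φ.source)
    (hφ : ContMDiffOn I 𝓘(ℝ, X) ∞ φ φ.source) (hφs : ContMDiffOn 𝓘(ℝ, X) I ∞ φ.symm φ.target)
    (hK : IsCompact (φ.target ∩ Metric.closedBall a b.rOut)) (hw : ContDiff ℝ ∞ w)
    (hwt : ∀ z ∈ φ.target ∩ Metric.ball a b.rOut, ∀ s ∈ Icc (0 : ℝ) 1, z + s • w z ∈ φ.target)
    {f : M → ℝ} (hlt : ∀ z ∈ φ.target ∩ Metric.ball a b.rOut, w z ≠ 0 → ∀ s ∈ Ioc (0 : ℝ) 1,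
      f (φ.symm (z + s • w z)) < f (φ.symm z)) :
    IsDescendingHomotopy I f {x | x ∈ φ.source → φ x ∈ Metric.ball a b.rOut → w (φ x) = 0}
      (displacement φ b w) := by
  have hdich : ∀ t x, displacement φ b w (t, x) = x ∨ f (displacement φ b w (t, x)) < f x := by
    intro t x
    refine or_iff_not_imp_left.2 fun hne => ?_
    obtain ⟨hxs, hsw⟩ : x ∈ φ.source ∧
        (Real.smoothTransition (1 - t) * b (φ x)) • w (φ x) ≠ 0 := by
      contrapose! hne
      exact displacement_of_smul_eq_zero hne
    have hxb : φ x ∈ Metric.ball a b.rOut := by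
      contrapose! hsw
      exact smul_eq_zero_of_notMem_ball hsw _ _
    have hs := smoothTransition_mul_contDiffBump_mem_Icc b (1 - t) (φ x)
    have h := hlt _ ⟨φ.map_source hxs, hxb⟩ (right_ne_zero_of_smul hsw) _
      ⟨hs.1.lt_of_ne' (left_ne_zero_of_smul hsw), hs.2⟩
    rw [φ.left_inv hxs] at h
    rwa [displacement, if_pos hxs]
  refine ⟨contMDiff_displacement hs hφ hφs hK hw hwt, fun x => ?_, fun t x => ?_, fun x hx => ?_,
    hdich 0⟩
  · exact displacement_of_smul_eq_zero fun _ => by simp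
  · exact (hdich t x).elim (fun h => (congrArg f h).le) le_of_lt
  · refine displacement_of_smul_eq_zero fun hxs => ?_
    by_cases hxb : φ x ∈ Metric.ball a b.rOut
    · rw [hx hxs hxb, smul_zero]
    · exact smul_eq_zero_of_notMem_ball hxb _ _

end Displacement

section DescentDirection

variable {E : Type*} [NormedAddCommGroup E] [NormedSpace ℝ E] {F : E → ℝ} {D : E →L[ℝ] ℝ}
  {R S : Set E} {a y : E}

theorem exists_mem_apply_sub_ne_zero (hD : D ≠ 0) (hS : IsOpen S) (hne : S.Nonempty) (a : E) :
    ∃ y ∈ S, D (y - a) ≠ 0 := by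
  contrapose! hD
  obtain ⟨z, hz⟩ := hne
  have hconst : D =ᶠ[𝓝 z] fun _ => D a := by
    filter_upwards [hS.mem_nhds hz] with y hy
    rw [← sub_eq_zero, ← map_sub, hD y hy]
  exact (D.hasFDerivAt.congr_of_eventuallyEq hconst.symm).unique (hasFDerivAt_const _ _)

theorem exists_mem_interior_apply_sub_neg (hD : D ≠ 0) (ha : a ∈ interior R) :
    ∃ y ∈ interior R, D (y - a) < 0 := by
  let refl : E → E := fun y => a + a - y
  obtain ⟨y, ⟨hy, hy'⟩, hDy⟩ := exists_mem_apply_sub_ne_zero (S := interior R ∩ refl ⁻¹' interior R)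
    hD (isOpen_interior.inter (isOpen_interior.preimage (by fun_prop)))
    ⟨a, ha, by rwa [mem_preimage, show refl a = a from add_sub_cancel_right a a]⟩ a
  rcases hDy.lt_or_gt with h | h
  · exact ⟨y, hy, h⟩
  · refine ⟨refl y, hy', ?_⟩
    rw [show refl y - a = -(y - a) by simp only [refl]; abel, map_neg]
    exact neg_lt_zero.2 h

theorem exists_mem_interior_fderivWithin_neg_of_isLocalMaxOn (hmax : IsLocalMaxOn F R a)
    (hR : Convex ℝ R) (hne : (interior R).Nonempty) (ha : a ∈ R) (hF : fderivWithin ℝ F R a ≠ 0) :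
    ∃ y ∈ interior R, fderivWithin ℝ F R a (y - a) < 0 := by
  obtain ⟨y, hy, hDy⟩ := exists_mem_apply_sub_ne_zero hF isOpen_interior hne a
  exact ⟨y, hy, (hmax.fderivWithin_nonpos (sub_mem_posTangentConeAt_of_segment_subset
    (hR.segment_subset ha (interior_subset hy)))).lt_of_ne hDy⟩

theorem exists_forall_add_smul_smul_sub_mem (hR : Convex ℝ R) (hy : y ∈ interior R)
    (hS : S ∈ 𝓝[R] a) :
    ∃ κ > (0 : ℝ), ∃ ρ > 0, ∀ z ∈ R ∩ Metric.closedBall a ρ, ∀ s ∈ Icc (0 : ℝ) 1,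
      z + s • κ • (y - a) ∈ R ∩ S := by
  obtain ⟨δ, hδ, hδy⟩ := Metric.mem_nhds_iff.1 (mem_interior_iff_mem_nhds.1 hy)
  obtain ⟨r, hr, hrS⟩ := Metric.mem_nhdsWithin_iff.1 hS
  obtain ⟨κ, hκ, hκ1, hκr⟩ : ∃ κ > 0, κ ≤ 1 ∧ κ * ‖y - a‖ < r / 2 := by
    obtain ⟨κ, hκ, hκr⟩ := exists_pos_mul_lt (half_pos hr) ‖y - a‖
    refine ⟨min κ 1, lt_min hκ one_pos, min_le_right _ _, hκr.trans_le' ?_⟩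
    rw [mul_comm]
    gcongr
    exact min_le_left _ _
  refine ⟨κ, hκ, min (δ / 2) (r / 2), by positivity, fun z hz s hs => ?_⟩
  have hzδ : dist z a ≤ δ / 2 := hz.2.trans (min_le_left _ _)
  have hzr : dist z a ≤ r / 2 := hz.2.trans (min_le_right _ _)
  have hmem : z + s • κ • (y - a) ∈ R := by
    have hyz : y + (z - a) ∈ R := hδy (by
      rw [Metric.mem_ball, dist_self_add_left, ← dist_eq_norm]
      linarith)
    rw [smul_smul, show y - a = y + (z - a) - z by abel]
    exact hR.add_smul_sub_mem hz.1 hyz ⟨mul_nonneg hs.1 hκ.le, mul_le_one₀ hs.2 hκ.le hκ1⟩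
  have hnorm : ‖s • κ • (y - a)‖ ≤ κ * ‖y - a‖ := by
    rw [norm_smul, norm_smul, Real.norm_of_nonneg hs.1, Real.norm_of_nonneg hκ.le]
    exact mul_le_of_le_one_left (by positivity) hs.2
  refine ⟨hmem, hrS ⟨?_, hmem⟩⟩
  calc dist (z + s • κ • (y - a)) a
      ≤ dist (z + s • κ • (y - a)) z + dist z a := dist_triangle _ _ _
    _ = ‖s • κ • (y - a)‖ + dist z a := by rw [dist_self_add_left]
    _ < r := by linarith

theorem lt_of_forall_segment_fderivWithin_neg {x : E} (hR : segment ℝ x y ⊆ R)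
    (hF : ∀ z ∈ segment ℝ x y, DifferentiableWithinAt ℝ F R z)
    (hneg : ∀ z ∈ segment ℝ x y, fderivWithin ℝ F R z (y - x) < 0) : F y < F x := by
  obtain ⟨z, hz, hzeq⟩ := domain_mvt (fun z hz => (hF z hz).hasFDerivWithinAt.mono hR)
    (convex_segment x y) (left_mem_segment ℝ x y) (right_mem_segment ℝ x y)
  exact sub_neg.1 (hzeq ▸ hneg z hz)

end DescentDirection

section Push

variable {E : Type*} [NormedAddCommGroup E] [NormedSpace ℝ E]
  {H : Type*} [TopologicalSpace H] {I : ModelWithCorners ℝ E H}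
  {M : Type*} [TopologicalSpace M] [ChartedSpace H M] {f : M → ℝ} {q : M}

theorem exists_mem_interior_range_fderivWithin_neg (hf : MDifferentiableAt I 𝓘(ℝ, ℝ) f q)
    (hq : ¬ IsCriticalPt I f q) (hmax : I.IsBoundaryPoint q → IsLocalMax f q) :
    ∃ y ∈ interior (range I), fderivWithin ℝ (f ∘ (extChartAt I q).symm) (range I)
      (extChartAt I q q) (y - extChartAt I q q) < 0 := by
  have hD : fderivWithin ℝ (f ∘ (extChartAt I q).symm) (range I) (extChartAt I q q) ≠ 0 :=
    fun h => hq (hf.mfderiv.trans h)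
  rcases I.isInteriorPoint_or_isBoundaryPoint q with hi | hb
  · exact exists_mem_interior_apply_sub_neg hD hi
  · have hloc : IsLocalMaxOn (f ∘ (extChartAt I q).symm) (range I) (extChartAt I q q) := by
      have hcont := (continuousAt_extChartAt_symm (I := I) q).continuousWithinAt (s := range I)
      refine IsMaxFilter.comp_tendsto (g := (extChartAt I q).symm) ?_ hcont
      rw [extChartAt_to_inv]
      exact hmax hb
    exact exists_mem_interior_fderivWithin_neg_of_isLocalMaxOn hloc I.convex_range
      I.nonempty_interior (mem_range_self _) hD

variable [IsManifold I ∞ M]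

theorem contDiffWithinAt_comp_extChartAt_symm (hf : ContMDiff I 𝓘(ℝ, ℝ) ∞ f) {z : E}
    (hz : z ∈ (extChartAt I q).target) :
    ContDiffWithinAt ℝ ∞ (f ∘ (extChartAt I q).symm) (range I) z :=
  (contMDiffOn_iff_contDiffOn.1
    (hf.comp_contMDiffOn (contMDiffOn_extChartAt_symm q)) z hz).mono_of_mem_nhdsWithin
    (extChartAt_target_mem_nhdsWithin_of_mem hz)

theorem eventually_fderivWithin_comp_extChartAt_symm_neg (hf : ContMDiff I 𝓘(ℝ, ℝ) ∞ f) {v : E}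
    (hv : fderivWithin ℝ (f ∘ (extChartAt I q).symm) (range I) (extChartAt I q q) v < 0) :
    ∀ᶠ z in 𝓝[range I] (extChartAt I q q),
      fderivWithin ℝ (f ∘ (extChartAt I q).symm) (range I) z v < 0 := by
  have hcont := ((contDiffWithinAt_comp_extChartAt_symm hf (mem_extChartAt_target q)
    ).fderivWithin_right (m := 0) I.uniqueDiffOn (by simp) (mem_range_self _)).continuousWithinAt
  exact (hcont.clm_apply continuousWithinAt_const).eventually (gt_mem_nhds hv)

theorem exists_forall_apply_extChartAt_symm_add_smul_lt (hf : ContMDiff I 𝓘(ℝ, ℝ) ∞ f) {y : E}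
    (hy : y ∈ interior (range I))
    (hneg : fderivWithin ℝ (f ∘ (extChartAt I q).symm) (range I) (extChartAt I q q)
      (y - extChartAt I q q) < 0) {S : Set E} (hS : S ∈ 𝓝[range I] (extChartAt I q q)) :
    ∃ v : E, ∃ ρ > 0, ∀ z ∈ range I ∩ Metric.closedBall (extChartAt I q q) ρ,
      (∀ s ∈ Icc (0 : ℝ) 1, z + s • v ∈ (extChartAt I q).target ∩ S) ∧
      ∀ s ∈ Ioc (0 : ℝ) 1,
        f ((extChartAt I q).symm (z + s • v)) < f ((extChartAt I q).symm z) := by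
  obtain ⟨κ, hκ, ρ, hρ, hseg⟩ := exists_forall_add_smul_smul_sub_mem I.convex_range hy
    (inter_mem (inter_mem (extChartAt_target_mem_nhdsWithin q) hS)
      (eventually_fderivWithin_comp_extChartAt_symm_neg hf hneg))
  refine ⟨κ • (y - extChartAt I q q), ρ, hρ, fun z hz => ⟨fun s hs => (hseg z hz s hs).2.1,
    fun s hs => ?_⟩⟩
  have hsub : ∀ u ∈ segment ℝ z (z + s • κ • (y - extChartAt I q q)),
      ∃ t ∈ Icc (0 : ℝ) 1, u = z + t • κ • (y - extChartAt I q q) := by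
    rw [segment_eq_image']
    rintro _ ⟨t, ht, rfl⟩
    exact ⟨t * s, unitInterval.mul_mem ht (Ioc_subset_Icc_self hs), by
      simp only [add_sub_cancel_left, smul_smul, mul_assoc]⟩
  refine lt_of_forall_segment_fderivWithin_neg (F := f ∘ (extChartAt I q).symm) (R := range I)
    ?_ ?_ ?_
  · rintro u hu
    obtain ⟨t, ht, rfl⟩ := hsub u hu
    exact (hseg z hz t ht).1
  · rintro u hu
    obtain ⟨t, ht, rfl⟩ := hsub u hu
    exact (contDiffWithinAt_comp_extChartAt_symm hf (hseg z hz t ht).2.1.1).differentiableWithinAt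
      (by simp)
  · rintro u hu
    obtain ⟨t, ht, rfl⟩ := hsub u hu
    rw [add_sub_cancel_left, map_smul, map_smul]
    exact mul_neg_of_pos_of_neg hs.1 (mul_neg_of_pos_of_neg hκ (hseg z hz t ht).2.2)

theorem exists_isDescendingHomotopy_lt_of_fderivWithin_neg [FiniteDimensional ℝ E] [T2Space M]
    (hf : ContMDiff I 𝓘(ℝ, ℝ) ∞ f) {e : Set M} (he : IsClosed e) (hqe : q ∉ e) {y : E}
    (hy : y ∈ interior (range I))
    (hneg : fderivWithin ℝ (f ∘ (extChartAt I q).symm) (range I) (extChartAt I q q)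
      (y - extChartAt I q q) < 0) :
    ∃ h, IsDescendingHomotopy I f e h ∧ ∀ᶠ x in 𝓝 q, f (h (0, x)) < f x := by
  set φ := extChartAt I q
  have hen : ∀ᶠ z in 𝓝[range I] (φ q), φ.symm z ∉ e :=
    (continuousAt_extChartAt_symm q).continuousWithinAt.eventually
      (he.isOpen_compl.mem_nhds (by rwa [extChartAt_to_inv]))
  obtain ⟨v, ρ, hρ, hv⟩ := exists_forall_apply_extChartAt_symm_add_smul_lt hf hy hneg hen
  have htarget : φ.target ⊆ range I := extChartAt_target_subset_range q
  have hmem : ∀ z ∈ range I ∩ Metric.closedBall (φ q) ρ, z ∈ φ.target ∧ φ.symm z ∉ e :=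
    fun z hz => by
      have h := (hv z hz).1 0 (by simp)
      rwa [zero_smul, add_zero] at h
  let b : ContDiffBump (φ q) := ⟨ρ / 2, ρ, half_pos hρ, half_lt_self hρ⟩
  have hball : φ.target ∩ Metric.ball (φ q) b.rOut ⊆ range I ∩ Metric.closedBall (φ q) ρ :=
    inter_subset_inter htarget Metric.ball_subset_closedBall
  have hK : IsCompact (φ.target ∩ Metric.closedBall (φ q) b.rOut) := by
    have : φ.target ∩ Metric.closedBall (φ q) ρ = range I ∩ Metric.closedBall (φ q) ρ :=
      (inter_subset_inter_left _ htarget).antisymm fun z hz => ⟨(hmem z hz).1, hz.2⟩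
    exact this ▸ (isCompact_closedBall _ _).inter_left I.isClosed_range
  have hdesc := isDescendingHomotopy_displacement (b := b) (w := fun _ => v) (f := f)
    (isOpen_extChartAt_source q) (by rw [extChartAt_source]; exact contMDiffOn_extChartAt)
    (contMDiffOn_extChartAt_symm q) hK contDiff_const
    (fun z hz s hs => ((hv z (hball hz)).1 s hs).1) (fun z hz _ => (hv z (hball hz)).2)
  refine ⟨_, hdesc.mono ?_, ?_⟩
  · intro x hxe hx hxb
    refine absurd hxe ?_
    have h := (hmem (φ x) (hball ⟨φ.map_source hx, hxb⟩)).2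
    rwa [φ.left_inv hx] at h
  · filter_upwards [extChartAt_source_mem_nhds (I := I) q,
      (continuousAt_extChartAt (I := I) q).preimage_mem_nhds
        (Metric.closedBall_mem_nhds _ (half_pos hρ))] with x hx hxb
    have h := (hv (φ x) ⟨htarget (φ.map_source hx),
      Metric.closedBall_subset_closedBall (half_le_self hρ.le) hxb⟩).2 1 (by simp)
    rw [one_smul, φ.left_inv hx] at h
    rwa [displacement_zero (b := b) hx hxb]

theorem exists_isDescendingHomotopy_lt_of_not_isCriticalPt [FiniteDimensional ℝ E] [T2Space M]
    (hf : ContMDiff I 𝓘(ℝ, ℝ) ∞ f) {e : Set M} (he : IsClosed e) (hqe : q ∉ e)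
    (hq : ¬ IsCriticalPt I f q) (hmax : I.IsBoundaryPoint q → IsLocalMax f q) :
    ∃ h, IsDescendingHomotopy I f e h ∧ ∀ᶠ x in 𝓝 q, f (h (0, x)) < f x := by
  obtain ⟨y, hy, hneg⟩ :=
    exists_mem_interior_range_fderivWithin_neg (hf.mdifferentiable (by simp) q) hq hmax
  exact exists_isDescendingHomotopy_lt_of_fderivWithin_neg hf he hqe hy hneg

end Push

section MorseChart

theorem mk_zero_mem_ball_zero_iff {X Y : Type*} [NormedAddCommGroup X]
    [NormedAddCommGroup Y] {x : X} {r : ℝ} :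
    (x, (0 : Y)) ∈ Metric.ball 0 r ↔ x ∈ Metric.ball 0 r := by
  rw [mem_ball_zero_iff, mem_ball_zero_iff, Prod.norm_mk, norm_zero,
    max_eq_left (norm_nonneg _)]

variable {E : Type*} [NormedAddCommGroup E] [NormedSpace ℝ E]
  {H : Type*} [TopologicalSpace H] (I : ModelWithCorners ℝ E H)
  {M : Type*} [TopologicalSpace M] [ChartedSpace H M]
  {X Y : Type*} [NormedAddCommGroup X] [NormedSpace ℝ X] [NormedAddCommGroup Y] [NormedSpace ℝ Y]

/-- Smooth coordinates `(x, y)` centred at `p`, covering at least the ball of radius `r`, in which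
`f` is `f p - ‖x‖² + ‖y‖²`. They are the Morse coordinates at a critical point `p`; the norm of
`X × Y` is the maximum of the two norms, so that the ball is a product of balls. -/
structure IsMorseChart (f : M → ℝ) (p : M) (r : ℝ) (φ : PartialEquiv M (X × Y)) : Prop where
  radius_pos : 0 < r
  isOpen_source : IsOpen φ.source
  isOpen_target : IsOpen φ.target
  contMDiffOn : ContMDiffOn I 𝓘(ℝ, X × Y) ∞ φ φ.source
  contMDiffOn_symm : ContMDiffOn 𝓘(ℝ, X × Y) I ∞ φ.symm φ.target
  ball_subset : Metric.ball 0 r ⊆ φ.target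
  symm_zero : φ.symm 0 = p
  apply_symm : ∀ z ∈ Metric.ball 0 r, f (φ.symm z) = f p - ‖z.1‖ ^ 2 + ‖z.2‖ ^ 2

/-- The part of the disk `y = 0` of a Morse chart that lies in `f ≥ f p - ε`. -/
def descendingDisk (φ : PartialEquiv M (X × Y)) (ε : ℝ) : Set M :=
  (fun x => φ.symm (x, 0)) '' Metric.closedBall 0 (√ε)

variable {I}

theorem exists_isMorseChart [FiniteDimensional ℝ E] [IsManifold I ∞ M] {f : M → ℝ}
    (hf : ContMDiff I 𝓘(ℝ, ℝ) ∞ f) {p : M} (hpi : I.IsInteriorPoint p) (hp : IsCriticalPt I f p)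
    (hnd : (chartHessian I f p).Nondegenerate) :
    ∃ (m : ℕ) (φ : PartialEquiv M (MorseModel (morseIndex I f p) m)) (r : ℝ),
      IsMorseChart I f p r φ := by
  obtain ⟨m, θ, ⟨P, hpP, hθP⟩, hθp, hfθ⟩ := exists_isLocalDiffeomorphAt_morseModel hf hpi hp hnd
  have hP0 : P.toPartialEquiv p = 0 := (hθP hpP).symm.trans hθp
  have h0 : (0 : MorseModel (morseIndex I f p) m) ∈ P.target := hP0 ▸ P.map_source hpP
  have hsymm0 : P.toPartialEquiv.symm 0 = p := hP0 ▸ P.left_inv hpP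
  have hcont : ContinuousAt P.toPartialEquiv.symm 0 :=
    P.contMDiffOn_invFun.continuousOn.continuousAt (P.open_target.mem_nhds h0)
  have hfθ0 : ∀ᶠ x in 𝓝 (P.toPartialEquiv.symm 0), f x = f p - ‖(θ x).1‖ ^ 2 + ‖(θ x).2‖ ^ 2 := by
    rwa [hsymm0]
  have hnear : ∀ᶠ z in 𝓝 (0 : MorseModel (morseIndex I f p) m), z ∈ P.target ∧
      f (P.toPartialEquiv.symm z) = f p - ‖z.1‖ ^ 2 + ‖z.2‖ ^ 2 := by
    filter_upwards [P.open_target.mem_nhds h0, hcont.eventually hfθ0] with z hz hfz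
    have hθz : θ (P.toPartialEquiv.symm z) = z :=
      (hθP (P.map_target hz)).trans (P.right_inv hz)
    rw [hθz] at hfz
    exact ⟨hz, hfz⟩
  obtain ⟨r, hr, hball⟩ := Metric.eventually_nhds_iff_ball.1 hnear
  exact ⟨m, P.toPartialEquiv, r, hr, P.open_source, P.open_target, P.contMDiffOn_toFun,
    P.contMDiffOn_invFun, fun z hz => (hball z hz).1, hsymm0, fun z hz => (hball z hz).2⟩

namespace IsMorseChart

variable {f : M → ℝ} {p : M} {r ε : ℝ} {φ : PartialEquiv M (X × Y)}

theorem apply_symm_mk_zero (hφ : IsMorseChart I f p r φ) {x : X} (hx : x ∈ Metric.ball 0 r) :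
    f (φ.symm (x, 0)) = f p - ‖x‖ ^ 2 := by
  rw [hφ.apply_symm _ (mk_zero_mem_ball_zero_iff.2 hx), norm_zero, zero_pow two_ne_zero, add_zero]

theorem apply_symm_add_smul_lt (hφ : IsMorseChart I f p r φ) {z : X × Y}
    (hz : z ∈ Metric.ball 0 r) (hz2 : z.2 ≠ 0) {s : ℝ} (hs : s ∈ Ioc (0 : ℝ) 1)
    (hsz : z + s • ((0, -z.2) : X × Y) ∈ Metric.ball 0 r) :
    f (φ.symm (z + s • ((0, -z.2) : X × Y))) < f (φ.symm z) := by
  have hsnd : (z + s • ((0, -z.2) : X × Y)).2 = (1 - s) • z.2 := by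
    rw [Prod.snd_add, Prod.smul_snd, smul_neg, sub_smul, one_smul, sub_eq_add_neg]
  have hfst : (z + s • ((0, -z.2) : X × Y)).1 = z.1 := by
    rw [Prod.fst_add, Prod.smul_fst, smul_zero, add_zero]
  rw [hφ.apply_symm _ hsz, hφ.apply_symm _ hz, hsnd, hfst, norm_smul,
    Real.norm_of_nonneg (sub_nonneg.2 hs.2)]
  have hlt : (1 - s) * ‖z.2‖ < ‖z.2‖ :=
    mul_lt_of_lt_one_left (norm_pos_iff.2 hz2) (sub_lt_self _ hs.1)
  have hnonneg : 0 ≤ (1 - s) * ‖z.2‖ := mul_nonneg (sub_nonneg.2 hs.2) (norm_nonneg _)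
  gcongr

theorem exists_collapse [T2Space M] [FiniteDimensional ℝ X] [FiniteDimensional ℝ Y]
    (hφ : IsMorseChart I f p r φ) (hεr : √ε < r) :
    ∃ h, IsDescendingHomotopy I f (descendingDisk φ ε) h ∧
      ∀ z ∈ Metric.ball 0 (r / 3), h (0, φ.symm z) = φ.symm (z.1, 0) := by
  have hr := hφ.radius_pos
  let b : ContDiffBump (0 : X × Y) := ⟨r / 3, r / 2, by positivity, by linarith⟩
  let w : X × Y → X × Y := fun z => (0, -z.2)
  have hw : ContDiff ℝ ∞ w := contDiff_const.prodMk contDiff_snd.neg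
  have hball : Metric.ball (0 : X × Y) b.rOut ⊆ Metric.ball 0 r :=
    Metric.ball_subset_ball (by simp only [b]; linarith)
  have hK : IsCompact (φ.target ∩ Metric.closedBall 0 b.rOut) := by
    rw [inter_eq_right.2 ((Metric.closedBall_subset_ball (by simp only [b]; linarith)).trans
      hφ.ball_subset)]
    exact isCompact_closedBall _ _
  have hseg : ∀ z ∈ φ.target ∩ Metric.ball 0 b.rOut, ∀ s ∈ Icc (0 : ℝ) 1,
      z + s • w z ∈ Metric.ball 0 r := by
    intro z hz s hs
    have hz0 : z + w z ∈ Metric.ball 0 b.rOut := by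
      have hzw : z + w z = (z.1, 0) := by ext <;> simp [w]
      rw [hzw, mk_zero_mem_ball_zero_iff, mem_ball_zero_iff]
      exact (norm_fst_le z).trans_lt (mem_ball_zero_iff.1 hz.2)
    exact hball ((convex_ball _ _).add_smul_mem hz.2 hz0 hs)
  have hdesc := isDescendingHomotopy_displacement hφ.isOpen_source hφ.contMDiffOn
    hφ.contMDiffOn_symm hK hw (fun z hz s hs => hφ.ball_subset (hseg z hz s hs))
    fun z hz hwz s hs => hφ.apply_symm_add_smul_lt (hball hz.2)
      (fun hz2 => hwz (by simp only [w, hz2, neg_zero, Prod.mk_zero_zero])) hs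
      (hseg z hz s (Ioc_subset_Icc_self hs))
  refine ⟨_, hdesc.mono ?_, fun z hz => ?_⟩
  · rintro _ ⟨x, hx, rfl⟩ - -
    have hxr : (x, 0) ∈ φ.target := hφ.ball_subset
      (mk_zero_mem_ball_zero_iff.2 (Metric.closedBall_subset_ball hεr hx))
    simp only [w, φ.right_inv hxr, neg_zero, Prod.mk_zero_zero]
  · have hzt : z ∈ φ.target := hφ.ball_subset (Metric.ball_subset_ball (by linarith) hz)
    rw [displacement_zero (b := b) (φ.map_target hzt), φ.right_inv hzt]
    · congr 1
      ext <;> simp [w]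
    · rw [φ.right_inv hzt]
      exact Metric.ball_subset_closedBall hz

theorem descendingDisk_subset_preimage_ball (hφ : IsMorseChart I f p r φ) {r' : ℝ} (hεr : √ε < r')
    (hr : r' ≤ r) : descendingDisk φ ε ⊆ φ.source ∩ φ ⁻¹' Metric.ball 0 r' := by
  rintro _ ⟨x, hx, rfl⟩
  have hxb : (x, (0 : Y)) ∈ Metric.ball 0 r' :=
    mk_zero_mem_ball_zero_iff.2 (Metric.closedBall_subset_ball hεr hx)
  have hxt := hφ.ball_subset (Metric.ball_subset_ball hr hxb)
  refine ⟨φ.map_target hxt, ?_⟩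
  rwa [mem_preimage, φ.right_inv hxt]

theorem mem_descendingDisk (hφ : IsMorseChart I f p r φ) : p ∈ descendingDisk φ ε :=
  ⟨0, Metric.mem_closedBall_self (Real.sqrt_nonneg ε), hφ.symm_zero⟩

theorem descendingDisk_subset_sublevel (hφ : IsMorseChart I f p r φ) (hεr : √ε < r) :
    descendingDisk φ ε ⊆ sublevel f (f p) := by
  rintro _ ⟨x, hx, rfl⟩
  exact (hφ.apply_symm_mk_zero (Metric.closedBall_subset_ball hεr hx)).trans_le
    (sub_le_self _ (sq_nonneg _))

theorem symm_mk_zero_mem_sublevel_union (hφ : IsMorseChart I f p r φ) {x : X}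
    (hx : x ∈ Metric.ball 0 r) :
    φ.symm (x, 0) ∈ sublevel f (f p - ε) ∪ descendingDisk φ ε := by
  by_cases hxε : ‖x‖ ≤ √ε
  · exact Or.inr ⟨x, mem_closedBall_zero_iff.2 hxε, rfl⟩
  · exact Or.inl ((hφ.apply_symm_mk_zero hx).trans_le
      (sub_le_sub_left (Real.lt_sq_of_sqrt_lt (not_le.1 hxε)).le _))

theorem descendingDisk_inter_sublevel (hφ : IsMorseChart I f p r φ) (hεr : √ε < r) :
    descendingDisk φ ε ∩ sublevel f (f p - ε) =
      (fun x => φ.symm (x, 0)) '' Metric.sphere 0 (√ε) := by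
  have hlevel : ∀ x ∈ Metric.closedBall (0 : X) (√ε),
      φ.symm (x, 0) ∈ sublevel f (f p - ε) ↔ √ε ≤ ‖x‖ := fun x hx => by
    rw [sublevel, mem_ofPred_eq, hφ.apply_symm_mk_zero (Metric.closedBall_subset_ball hεr hx),
      sub_le_sub_iff_left, Real.sqrt_le_left (norm_nonneg x)]
  rw [descendingDisk, ← image_inter_preimage]
  refine congrArg _ (Set.ext fun x => ⟨fun ⟨hx, hfx⟩ => ?_, fun hx => ?_⟩)
  · exact mem_sphere_zero_iff_norm.2 ((mem_closedBall_zero_iff.1 hx).antisymm ((hlevel x hx).1 hfx))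
  · have hxc := Metric.sphere_subset_closedBall hx
    exact ⟨hxc, (hlevel x hxc).2 (mem_sphere_zero_iff_norm.1 hx).ge⟩

theorem contMDiffOn_symm_mk_zero (hφ : IsMorseChart I f p r φ) :
    ContMDiffOn 𝓘(ℝ, X) I ∞ (fun x => φ.symm (x, 0)) (Metric.ball 0 r) :=
  hφ.contMDiffOn_symm.comp (contDiff_id.prodMk contDiff_const).contMDiff.contMDiffOn
    fun _ hx => hφ.ball_subset (mk_zero_mem_ball_zero_iff.2 hx)

theorem isClosed_descendingDisk [T2Space M] [FiniteDimensional ℝ X] (hφ : IsMorseChart I f p r φ)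
    (hεr : √ε < r) : IsClosed (descendingDisk φ ε) :=
  ((isCompact_closedBall _ _).image_of_continuousOn (hφ.contMDiffOn_symm_mk_zero.continuousOn.mono
    (Metric.closedBall_subset_ball hεr))).isClosed

theorem exists_mapsTo_sublevel_union_descendingDisk [FiniteDimensional ℝ E] [T2Space M]
    [IsManifold I ∞ M] [FiniteDimensional ℝ X] [FiniteDimensional ℝ Y]
    (hφ : IsMorseChart I f p r φ) (hf : ContMDiff I 𝓘(ℝ, ℝ) ∞ f) (hεr : √ε < r / 3) {d : ℝ}
    (hK : IsCompact (f ⁻¹' Icc (f p - ε) d))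
    (hmax : ∀ x ∈ f ⁻¹' Icc (f p - ε) d, I.IsBoundaryPoint x → IsLocalMax f x)
    (hcrit : ∀ x ∈ f ⁻¹' Icc (f p - ε) d, IsCriticalPt I f x → x = p) :
    ∃ g, IsDescendingHomotopy I f (descendingDisk φ ε) g ∧
      MapsTo (fun x => g (0, x)) (sublevel f d) (sublevel f (f p - ε) ∪ descendingDisk φ ε) := by
  have hr := hφ.radius_pos
  have hεr' : √ε < r := by linarith
  have hclosed := hφ.isClosed_descendingDisk hεr'
  let C := φ.source ∩ φ ⁻¹' Metric.ball 0 (r / 3)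
  have hC : IsOpen C := hφ.contMDiffOn.continuousOn.isOpen_inter_preimage hφ.isOpen_source
    Metric.isOpen_ball
  have hdC : descendingDisk φ ε ⊆ C := hφ.descendingDisk_subset_preimage_ball hεr (by linarith)
  obtain ⟨h₀, hh₀, hcollapse⟩ := hφ.exists_collapse hεr'
  obtain ⟨h₁, hh₁, hlt⟩ := exists_isDescendingHomotopy_lt_of_isCompact (hK.diff hC)
    fun x hx => exists_isDescendingHomotopy_lt_of_not_isCriticalPt hf hclosed
      (fun hxe => hx.2 (hdC hxe))
      (fun hxc => hx.2 (hdC (hcrit x hx.1 hxc ▸ hφ.mem_descendingDisk))) (hmax x hx.1)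
  have hC₀ : MapsTo (fun x => h₀ (0, x)) C (sublevel f (f p - ε) ∪ descendingDisk φ ε) := by
    rintro x ⟨hx, hxC⟩
    have hx₀ := hcollapse _ hxC
    rw [φ.left_inv hx] at hx₀
    refine mem_of_eq_of_mem hx₀ (hφ.symm_mk_zero_mem_sublevel_union ?_)
    have hxr : φ x ∈ Metric.ball 0 r := Metric.ball_subset_ball (by linarith) hxC
    exact mem_ball_zero_iff.2 ((norm_fst_le _).trans_lt (mem_ball_zero_iff.1 hxr))
  exact (hh₁.comp hh₀).exists_mapsTo hf.continuous hK hC subset_union_left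
    ((hh₁.comp hh₀).mapsTo_sublevel_union _) ((hh₁.mapsTo_sublevel_union _).comp hC₀)
    fun x hx => hh₁.comp_lt hh₀ (Or.inl (hlt x hx))

end IsMorseChart

theorem injective_mfderivWithin_of_eqOn_comp {θ : M → X} {Φ : Y → M} {ι : Y →L[ℝ] X} {s : Set Y}
    {u : Y} (hι : Function.Injective ι) (hθ : MDifferentiableAt I 𝓘(ℝ, X) θ (Φ u))
    (hΦ : MDifferentiableWithinAt 𝓘(ℝ, Y) I Φ s u) (hs : UniqueDiffWithinAt ℝ s u) (hu : u ∈ s)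
    (hθΦ : EqOn (θ ∘ Φ) ι s) : Function.Injective (mfderivWithin 𝓘(ℝ, Y) I Φ s u) := by
  have hcomp : mfderivWithin 𝓘(ℝ, Y) 𝓘(ℝ, X) (θ ∘ Φ) s u = ι := by
    rw [mfderivWithin_eq_fderivWithin, fderivWithin_congr hθΦ (hθΦ hu), ι.fderivWithin hs]
  rw [mfderiv_comp_mfderivWithin u hθ hΦ hs.uniqueMDiffWithinAt] at hcomp
  refine Function.Injective.of_comp (f := mfderiv I 𝓘(ℝ, X) θ (Φ u)) ?_
  rw [← ContinuousLinearMap.coe_comp, hcomp]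
  exact hι

theorem IsMorseChart.isAttachedCell_descendingDisk {k : ℕ} {f : M → ℝ} {p : M} {r ε : ℝ}
    {φ : PartialEquiv M (EuclideanSpace ℝ (Fin k) × Y)} (hφ : IsMorseChart I f p r φ)
    (hε : 0 < ε) (hεr : √ε < r) :
    IsAttachedCell I k (sublevel f (f p - ε)) (descendingDisk φ ε) := by
  have hsε : 0 < √ε := Real.sqrt_pos.2 hε
  let B : Set (EuclideanSpace ℝ (Fin k)) := Metric.closedBall 0 1
  let Φ : EuclideanSpace ℝ (Fin k) → M := fun u => φ.symm (√ε • u, 0)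
  have hball : (fun u => √ε • u) '' B = Metric.closedBall 0 (√ε) := by
    rw [image_smul, smul_closedBall' hsε.ne', smul_zero, Real.norm_of_nonneg hsε.le, mul_one]
  have hsphere : (fun u : EuclideanSpace ℝ (Fin k) => √ε • u) '' Metric.sphere 0 1 =
      Metric.sphere 0 (√ε) := by
    rw [image_smul, smul_sphere' hsε.ne', smul_zero, Real.norm_of_nonneg hsε.le, mul_one]
  have hmaps : ∀ u ∈ B, √ε • u ∈ Metric.ball 0 r := fun u hu =>
    Metric.closedBall_subset_ball hεr (hball.subset (mem_image_of_mem _ hu))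
  have htarget : ∀ u ∈ B, (√ε • u, 0) ∈ φ.target := fun u hu =>
    hφ.ball_subset (mk_zero_mem_ball_zero_iff.2 (hmaps u hu))
  have hΦ : ContMDiffOn 𝓘(ℝ, EuclideanSpace ℝ (Fin k)) I ∞ Φ B :=
    hφ.contMDiffOn_symm_mk_zero.comp (contDiff_const_smul _).contMDiff.contMDiffOn hmaps
  let ι : EuclideanSpace ℝ (Fin k) →L[ℝ] EuclideanSpace ℝ (Fin k) × Y :=
    √ε • ContinuousLinearMap.inl ℝ _ _
  have hι : Function.Injective ι :=
    (smul_right_injective _ hsε.ne').comp LinearMap.inl_injective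
  have hφΦ : EqOn (φ ∘ Φ) ι B := fun u hu => (φ.right_inv (htarget u hu)).trans (by simp [ι])
  refine ⟨Φ, hΦ, fun u hu v hv huv => hι ?_, fun u hu => ?_, ?_, ?_⟩
  · rw [← hφΦ hu, ← hφΦ hv]
    exact congrArg φ huv
  · have hunique : UniqueDiffWithinAt ℝ B u := uniqueDiffOn_convex (convex_closedBall _ _)
      ⟨0, Metric.ball_subset_interior_closedBall (Metric.mem_ball_self one_pos)⟩ u hu
    have hsource := hφ.isOpen_source.mem_nhds (φ.map_target (htarget u hu))
    exact injective_mfderivWithin_of_eqOn_comp hι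
      ((hφ.contMDiffOn.contMDiffAt hsource).mdifferentiableAt (by simp))
      ((hΦ u hu).mdifferentiableWithinAt (by simp)) hunique hu hφΦ
  · rw [descendingDisk, ← hball, image_image]
  · rw [hφ.descendingDisk_inter_sublevel hεr, ← hsphere, image_image]

end MorseChart

theorem mainTheorem12_general {E : Type*} [NormedAddCommGroup E] [NormedSpace ℝ E]
    [FiniteDimensional ℝ E] {H : Type*} [TopologicalSpace H] {I : ModelWithCorners ℝ E H}
    {M : Type*} [TopologicalSpace M] [T2Space M] [ChartedSpace H M] [IsManifold I ∞ M]
    {f : M → ℝ} (hf : ContMDiff I 𝓘(ℝ, ℝ) ∞ f) {p : M} (hpi : I.IsInteriorPoint p)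
    (hp : IsCriticalPt I f p) (hnd : (chartHessian I f p).Nondegenerate) {d : ℝ} (hpd : f p ≤ d)
    {ε₁ : ℝ} (hε₁ : 0 < ε₁) (hK : IsCompact (f ⁻¹' Icc (f p - ε₁) d))
    (hmax : ∀ x ∈ f ⁻¹' Icc (f p - ε₁) d, I.IsBoundaryPoint x → IsLocalMax f x)
    (hcrit : ∀ x ∈ f ⁻¹' Icc (f p - ε₁) d, IsCriticalPt I f x → x = p) :
    ∃ ε₀ > 0, ∀ ε : ℝ, 0 < ε → ε < ε₀ →
      ∃ h : ℝ × M → M,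
        ContMDiffOn (𝓘(ℝ, ℝ).prod I) I ∞ h (Icc (0 : ℝ) 1 ×ˢ sublevel f d) ∧
        (∀ t ∈ Icc (0 : ℝ) 1, ∀ x ∈ sublevel f d, h (t, x) ∈ sublevel f d) ∧
        (∀ x ∈ sublevel f d, h (1, x) = x) ∧
        ∃ e : Set M, e ⊆ sublevel f d ∧
          IsAttachedCell I (morseIndex I f p) (sublevel f (f p - ε)) e ∧
          ∀ x ∈ sublevel f d, h (0, x) ∈ sublevel f (f p - ε) ∪ e := by
  obtain ⟨m, φ, r, hφ⟩ := exists_isMorseChart hf hpi hp hnd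
  have hr := hφ.radius_pos
  refine ⟨min ε₁ ((r / 3) ^ 2), by positivity, fun ε hε hlt => ?_⟩
  have hεr₃ : √ε < r / 3 := (Real.sqrt_lt' (by positivity)).2 (lt_min_iff.1 hlt).2
  have hεr : √ε < r := by linarith
  have hsub : f ⁻¹' Icc (f p - ε) d ⊆ f ⁻¹' Icc (f p - ε₁) d :=
    preimage_mono (Icc_subset_Icc_left (sub_le_sub_left (lt_min_iff.1 hlt).1.le _))
  obtain ⟨g, hg, hmaps⟩ := hφ.exists_mapsTo_sublevel_union_descendingDisk hf hεr₃
    (hK.of_isClosed_subset (isClosed_Icc.preimage hf.continuous) hsub)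
    (fun x hx => hmax x (hsub hx)) fun x hx => hcrit x (hsub hx)
  exact ⟨g, hg.contMDiff.contMDiffOn, fun t _ x hx => (hg.le t x).trans hx,
    fun x _ => hg.apply_one x, descendingDisk φ ε,
    fun x hx => (hφ.descendingDisk_subset_sublevel hεr hx).trans hpd,
    hφ.isAttachedCell_descendingDisk hε hεr, hmaps⟩

end

theorem mainTheorem12 {n : ℕ} [NeZero n]
    {M : Type*} [TopologicalSpace M] [T2Space M] [CompactSpace M]
    [ChartedSpace (EuclideanHalfSpace n) M] [IsManifold (𝓡∂ n) ∞ M]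
    (hboundary : ((𝓡∂ n).boundary M).Nonempty)
    (f : M → ℝ) (hf01 : ∀ x, f x ∈ Set.Icc (0 : ℝ) 1)
    (hmorse : IsMorseFunction (𝓡∂ n) f)
    (hf1 : f ⁻¹' {1} = (𝓡∂ n).boundary M)
    (hmax : ∀ x ∈ (𝓡∂ n).interior M, ¬ IsLocalMax f x)
    (c d : ℝ) (hc : 0 ≤ c) (hcd : c < d) (hd : d ≤ 1)
    (k : ℕ) (hk : k < n)
    (p : M) (hpc : f p = c) (hp : IsCriticalPt (𝓡∂ n) f p) (hpk : morseIndex (𝓡∂ n) f p = k)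
    (ε₁ : ℝ) (hε₁ : 0 < ε₁)
    (hcrit : ∀ x ∈ f ⁻¹' Set.Icc (c - ε₁) d, IsCriticalPt (𝓡∂ n) f x → x = p) :
    ∃ ε₀ > 0, ∀ ε : ℝ, 0 < ε → ε < ε₀ →
      ∃ h : ℝ × M → M,
        ContMDiffOn (𝓘(ℝ, ℝ).prod (𝓡∂ n)) (𝓡∂ n) ∞ h (Set.Icc (0 : ℝ) 1 ×ˢ sublevel f d) ∧
        (∀ t ∈ Set.Icc (0 : ℝ) 1, ∀ x ∈ sublevel f d, h (t, x) ∈ sublevel f d) ∧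
        (∀ x ∈ sublevel f d, h (1, x) = x) ∧
        ∃ e : Set M, e ⊆ sublevel f d ∧
          IsAttachedCell (𝓡∂ n) k (sublevel f (c - ε)) e ∧
          ∀ x ∈ sublevel f d, h (0, x) ∈ sublevel f (c - ε) ∪ e := by
  subst hpk hpc
  have hf := hmorse.smooth
  have hboundary_max : ∀ x, (𝓡∂ n).IsBoundaryPoint x → f x = 1 := fun x hx => hf1.superset hx
  have hpi : (𝓡∂ n).IsInteriorPoint p := ((𝓡∂ n).isInteriorPoint_or_isBoundaryPoint p).resolve_right
    fun hpb => (hcd.trans_le hd).ne (hboundary_max p hpb)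
  exact mainTheorem12_general hf hpi hp (hmorse.nondegenerate p hp) hcd.le hε₁
    (isClosed_Icc.preimage hf.continuous).isCompact
    (fun x _ hx => .of_forall fun y => (hf01 y).2.trans_eq (hboundary_max x hx).symm) hcrit
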